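/- Let $R$ be an integral domain containing $\mathbb{Z}$ as a subring (that is, of characteristic $0$). For a simple graph $G$ with vertex set $X$, let $M(X;G)$ denote the partially commutative metabelian Lie $R$-algebra with defining graph $G$: the quotient of the free metabelian Lie $R$-algebra on $X$ (the free Lie $R$-algebra on $X$ modulo its second derived ideal) by the ideal generated by all brackets $[x,y]$ with $x,y\in X$ adjacent in $G$. Let $n,m\ge 3$, let $X$ and $Y$ be sets with $n$ and $m$ elements, and let $C_n$ and $C_m$ be cycles of length $n$ and $m$ with vertex sets $X$ and $Y$, respectively. Then $M(X;C_n)$ and $M(Y;C_m)$ are universally equivalent if and only if $n=m$. Here two Lie $R$-algebras are universally equivalent if they satisfy the same universal sentences, i.e. closed first-order formulas $\forall w_1\dots\forall w_k\,\varphi(w_1,\dots,w_k)$ with $\varphi$ quantifier-free, in the language with equality and function symbols $0$, $-$, $+$, $[\cdot,\cdot]$ and one unary symbol for multiplication by $r$ for each $r\in S$. The equivalence holds for every choice of the subset $S\subseteq R$; in particular for $S=R$ (the language of Lie $R$-algebras) and for $S=\emptyset$ (the language of Lie rings). -/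

import Mathlib

open scoped FirstOrder

universe u v w

/-! ### Partially commutative metabelian Lie algebras -/

section Algebra

variable (R : Type u) [CommRing R]

/-- The free metabelian Lie `R`-algebra on a set `X` of generators: the free Lie algebra modulo its
second derived ideal, that is, modulo the ideal generated by all `⁅⁅a, b⁆, ⁅c, d⁆⁆`. -/
abbrev FreeMetabelianLieAlgebra (X : Type v) : Type (max u v) :=
  FreeLieAlgebra R X ⧸ LieAlgebra.derivedSeries R (FreeLieAlgebra R X) 2

/-- The free generators of the free metabelian Lie algebra. -/
noncomputable def FreeMetabelianLieAlgebra.of {X : Type v} (x : X) : FreeMetabelianLieAlgebra R X :=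
  LieSubmodule.Quotient.mk (FreeLieAlgebra.of R x)

/-- The ideal of the free metabelian Lie algebra generated by the brackets of pairs of generators
that are adjacent in the graph `G`. -/
noncomputable def commutationIdeal {X : Type v} (G : SimpleGraph X) :
    LieIdeal R (FreeMetabelianLieAlgebra R X) :=
  LieSubmodule.lieSpan R (FreeMetabelianLieAlgebra R X)
    {a | ∃ x y : X, G.Adj x y ∧
      a = ⁅FreeMetabelianLieAlgebra.of R x, FreeMetabelianLieAlgebra.of R y⁆}

/-- The partially commutative metabelian Lie `R`-algebra `M(X; G)` with defining graph `G`. -/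
abbrev PartCommMetabelianLieAlgebra {X : Type v} (G : SimpleGraph X) : Type (max u v) :=
  FreeMetabelianLieAlgebra R X ⧸ commutationIdeal R G

end Algebra

/-! ### Universal theories of Lie algebras -/

section Logic

variable {R : Type u}

/-- The function symbols of the language of Lie algebras: `0`, `-`, `+`, the Lie bracket, and a
unary symbol for the multiplication by each scalar in the set `S`. -/
inductive LieFunc (S : Set R) : ℕ → Type u
  | zero : LieFunc S 0
  | neg : LieFunc S 1
  | add : LieFunc S 2
  | bracket : LieFunc S 2
  | smul (r : S) : LieFunc S 1

/-- The first-order language of Lie algebras with multiplication by the scalars in `S`. For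
`S = Set.univ` it is the language of Lie `R`-algebras, for `S = ∅` the language of Lie rings.
Equality is the only relation. -/
def lieLanguage (S : Set R) : FirstOrder.Language.{u, 0} where
  Functions := LieFunc S
  Relations := fun _ => Empty

/-- A Lie `R`-algebra as a first-order structure, with the natural interpretation. -/
instance lieStructure [CommRing R] (S : Set R) (L : Type w) [LieRing L] [LieAlgebra R L] :
    (lieLanguage S).Structure L where
  funMap := fun {_} f =>
    match f with
    | LieFunc.zero => fun _ => 0
    | LieFunc.neg => fun a => - a 0
    | LieFunc.add => fun a => a 0 + a 1
    | LieFunc.bracket => fun a => ⁅a 0, a 1⁆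
    | LieFunc.smul r => fun a => (r : R) • a 0
  RelMap := fun {_} r => Empty.elim r

/-- Two Lie `R`-algebras are universally equivalent in the language with scalars `S` if the same
universal sentences of this language hold in both of them. -/
def UniversallyEquivalent [CommRing R] (S : Set R) (L₁ : Type v) (L₂ : Type w)
    [LieRing L₁] [LieAlgebra R L₁] [LieRing L₂] [LieAlgebra R L₂] : Prop :=
  ∀ φ : (lieLanguage S).Sentence, φ.IsUniversal → (L₁ ⊨ φ ↔ L₂ ⊨ φ)

end Logic

/-! The number of chords of the cycle, i.e. of non-adjacent pairs of vertices, can be read off the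
universal theory, and it grows strictly with the length from length 3 on.

A chord `e` cuts the cycle into two arcs. Sending its ends to 0 and every other generator `x k` to
the pair of `X k` and `X k` times the indicator of one arc defines a homomorphism `CycleChord.hom`
into the affine Lie algebra over a polynomial ring: adjacent vertices that survive lie on the same
arc, so their images commute. These homomorphisms are jointly injective on the derived ideal
(`CycleChord.eq_zero_of_hom_vec_eq_zero`). In a fixed multidegree `β`, the Jacobi identity makes the
monomials differences `φ b - φ a` of a potential that is constant along the edges of the cycle
inside the support of `β`. So only the components of the support matter, and these are separated by
chords with both ends outside it.

For chords `e` and `e'`, let all vertices off `e` and all vertices off `e'` act on a bracket of two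
vertices separated by `e`. The homomorphism of a chord `d` kills the result unless `d = e` and `d =
e'`. Hence these elements vanish for `e ≠ e'` but not for `e = e'`. Conversely, let a tuple in the
algebra of another cycle satisfy the same equations and inequations. Each diagonal element survives
under the homomorphism of some chord `d e`. Polynomials form a domain, so `d e = d e'` with `e ≠ e'`
would make an off-diagonal element nonzero; thus `d` is injective. The system is finite and uses
only brackets and zero, so universal equivalence transfers its solvability, whatever the scalars in
the language. -/

/-! ### Metabelian Lie algebras and homomorphisms out of `M(X; G)` -/

/-- A Lie ring is metabelian if all brackets commute with each other. -/
def LieRing.IsMetabelian (L : Type*) [LieRing L] : Prop :=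
  ∀ a b c d : L, ⁅⁅a, b⁆, ⁅c, d⁆⁆ = 0

section Lift

variable {R : Type u} [CommRing R] {L : Type v} [LieRing L] [LieAlgebra R L]
  {L' : Type w} [LieRing L'] [LieAlgebra R L']

/-- A homomorphism of Lie algebras that vanishes on an ideal descends to the quotient. -/
def LieIdeal.quotientLift (I : LieIdeal R L) (f : L →ₗ⁅R⁆ L') (h : ∀ a ∈ I, f a = 0) :
    L ⧸ I →ₗ⁅R⁆ L' :=
  { I.toSubmodule.liftQ (f : L →ₗ[R] L') h with
    map_lie' := by
      intro a b
      induction a using Submodule.Quotient.induction_on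
      induction b using Submodule.Quotient.induction_on
      exact f.map_lie _ _ }

@[simp]
theorem LieIdeal.quotientLift_mk (I : LieIdeal R L) (f : L →ₗ⁅R⁆ L') (h : ∀ a ∈ I, f a = 0)
    (a : L) : I.quotientLift f h (LieSubmodule.Quotient.mk a) = f a := rfl

theorem LieHom.map_derivedSeries_two_eq_zero (hL : LieRing.IsMetabelian L') (f : L →ₗ⁅R⁆ L') :
    ∀ a ∈ LieAlgebra.derivedSeries R L 2, f a = 0 := by
  suffices LieAlgebra.derivedSeries R L 2 ≤ f.ker from fun a ha => f.mem_ker.1 (this ha)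
  have key : ∀ a ∈ LieAlgebra.derivedSeries R L 1, ∀ b ∈ LieAlgebra.derivedSeries R L 1,
      f ⁅a, b⁆ = 0 := by
    intro a ha b hb
    replace ha := (LieAlgebra.coe_derivedSeries_one_eq R L).le ha
    replace hb := (LieAlgebra.coe_derivedSeries_one_eq R L).le hb
    induction ha using Submodule.span_induction with
    | zero => simp
    | add _ _ _ _ h₁ h₂ => simp only [add_lie, map_add, h₁, h₂, add_zero]
    | smul r _ _ h₁ => simp only [smul_lie, map_smul, h₁, smul_zero]
    | mem a ha =>
      obtain ⟨p, q, rfl⟩ := ha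
      induction hb using Submodule.span_induction with
      | zero => simp
      | add _ _ _ _ h₁ h₂ => simp only [lie_add, map_add, h₁, h₂, add_zero]
      | smul r _ _ h₁ => simp only [lie_smul, map_smul, h₁, smul_zero]
      | mem b hb =>
        obtain ⟨p', q', rfl⟩ := hb
        simp only [LieHom.map_lie]
        exact hL _ _ _ _
  rw [LieAlgebra.derivedSeries_def, LieAlgebra.derivedSeriesOfIdeal_succ,
    LieSubmodule.lieIdeal_oper_eq_span, LieSubmodule.lieSpan_le]
  rintro _ ⟨⟨a, ha⟩, ⟨b, hb⟩, rfl⟩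
  exact f.mem_ker.2 (key a ha b hb)

theorem FreeMetabelianLieAlgebra.isMetabelian (X : Type v) :
    LieRing.IsMetabelian (FreeMetabelianLieAlgebra R X) := by
  intro a b c d
  induction a using Submodule.Quotient.induction_on
  induction b using Submodule.Quotient.induction_on
  induction c using Submodule.Quotient.induction_on
  induction d using Submodule.Quotient.induction_on
  simp only [← LieSubmodule.Quotient.mk_bracket]
  rw [LieSubmodule.Quotient.mk_eq_zero']
  exact LieSubmodule.lie_mem_lie
    (LieSubmodule.lie_mem_lie (LieSubmodule.mem_top _) (LieSubmodule.mem_top _))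
    (LieSubmodule.lie_mem_lie (LieSubmodule.mem_top _) (LieSubmodule.mem_top _))

end Lift

namespace PartCommMetabelianLieAlgebra

variable (R : Type u) [CommRing R] {X : Type v} (G : SimpleGraph X)

/-- The canonical generators of `M(X; G)`. -/
noncomputable def of (x : X) : PartCommMetabelianLieAlgebra R G :=
  LieSubmodule.Quotient.mk (FreeMetabelianLieAlgebra.of R x)

theorem isMetabelian : LieRing.IsMetabelian (PartCommMetabelianLieAlgebra R G) := by
  intro a b c d
  induction a using Submodule.Quotient.induction_on
  induction b using Submodule.Quotient.induction_on
  induction c using Submodule.Quotient.induction_on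
  induction d using Submodule.Quotient.induction_on
  simp only [← LieSubmodule.Quotient.mk_bracket]
  rw [FreeMetabelianLieAlgebra.isMetabelian]
  rfl

variable {G} in
theorem lie_of_of_adj {x y : X} (h : G.Adj x y) : ⁅of R G x, of R G y⁆ = 0 := by
  rw [of, of, ← LieSubmodule.Quotient.mk_bracket, LieSubmodule.Quotient.mk_eq_zero']
  exact LieSubmodule.subset_lieSpan ⟨x, y, h, rfl⟩

section

variable {R G} {L : Type w} [LieRing L] [LieAlgebra R L]

/-- The universal property of `M(X; G)` among metabelian Lie algebras. -/
noncomputable def lift (hL : LieRing.IsMetabelian L) (f : X → L)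
    (hf : ∀ x y, G.Adj x y → ⁅f x, f y⁆ = 0) : PartCommMetabelianLieAlgebra R G →ₗ⁅R⁆ L :=
  LieIdeal.quotientLift _
    (LieIdeal.quotientLift _ (FreeLieAlgebra.lift R f)
      (LieHom.map_derivedSeries_two_eq_zero hL _)) <| by
    suffices commutationIdeal R G ≤ LieHom.ker (LieIdeal.quotientLift _ (FreeLieAlgebra.lift R f)
        (LieHom.map_derivedSeries_two_eq_zero hL _)) from fun a ha => LieHom.mem_ker.1 (this ha)
    rw [commutationIdeal, LieSubmodule.lieSpan_le]
    rintro _ ⟨x, y, hxy, rfl⟩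
    refine LieHom.mem_ker.2 ?_
    rw [LieHom.map_lie]
    simp only [FreeMetabelianLieAlgebra.of, LieIdeal.quotientLift_mk, FreeLieAlgebra.lift_of_apply]
    exact hf x y hxy

@[simp]
theorem lift_of (hL : LieRing.IsMetabelian L) (f : X → L)
    (hf : ∀ x y, G.Adj x y → ⁅f x, f y⁆ = 0) (x : X) : lift hL f hf (of R G x) = f x := by
  simp only [lift, of, FreeMetabelianLieAlgebra.of, LieIdeal.quotientLift_mk,
    FreeLieAlgebra.lift_of_apply]

theorem hom_ext {f g : PartCommMetabelianLieAlgebra R G →ₗ⁅R⁆ L}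
    (h : ∀ x, f (of R G x) = g (of R G x)) : f = g := by
  let p : FreeLieAlgebra R X →ₗ⁅R⁆ PartCommMetabelianLieAlgebra R G :=
    { toFun := fun a => LieSubmodule.Quotient.mk (LieSubmodule.Quotient.mk a)
      map_add' := fun _ _ => rfl
      map_smul' := fun _ _ => rfl
      map_lie' := rfl }
  have hp : f.comp p = g.comp p := FreeLieAlgebra.hom_ext h
  ext a
  induction a using Submodule.Quotient.induction_on with | _ a
  induction a using Submodule.Quotient.induction_on with | _ a
  exact LieHom.congr_fun hp a

/-- The canonical generators generate `M(X; G)` as a Lie algebra. -/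
theorem eq_top_of_forall_of_mem (S : LieSubalgebra R (PartCommMetabelianLieAlgebra R G))
    (h : ∀ x, of R G x ∈ S) : S = ⊤ := by
  have hS : LieRing.IsMetabelian S := fun a b c d =>
    Subtype.ext (isMetabelian R G (a : PartCommMetabelianLieAlgebra R G) b c d)
  -- The generators lift to a map into `S`; followed by the inclusion it fixes the generators, so it
  -- is the identity and every element lies in `S`.
  let f := lift (R := R) (G := G) hS (fun x => ⟨of R G x, h x⟩)
    fun x y hxy => Subtype.ext (lie_of_of_adj R hxy)
  have hf : S.incl.comp f = LieHom.id := hom_ext fun x => by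
    rw [LieHom.comp_apply, lift_of]
    rfl
  refine eq_top_iff.2 fun a _ => ?_
  have : (f a : PartCommMetabelianLieAlgebra R G) = a := LieHom.congr_fun hf a
  exact this ▸ (f a).2

end

variable {G} in
/-- Isomorphic graphs define isomorphic Lie algebras. -/
noncomputable def congr {Y : Type w} {H : SimpleGraph Y} (e : G ≃g H) :
    PartCommMetabelianLieAlgebra R G ≃ₗ⁅R⁆ PartCommMetabelianLieAlgebra R H :=
  let f := lift (R := R) (G := G) (isMetabelian R H) (fun x => of R H (e x))
    fun _ _ h => lie_of_of_adj R (e.map_adj_iff.2 h)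
  let g := lift (R := R) (G := H) (isMetabelian R G) (fun y => of R G (e.symm y))
    fun _ _ h => lie_of_of_adj R (e.symm.map_adj_iff.2 h)
  have hgf : g.comp f = LieHom.id := hom_ext fun x => by
    simp only [f, g, LieHom.comp_apply, lift_of, RelIso.symm_apply_apply, LieHom.id_apply]
  have hfg : f.comp g = LieHom.id := hom_ext fun x => by
    simp only [f, g, LieHom.comp_apply, lift_of, RelIso.apply_symm_apply, LieHom.id_apply]
  { f with
    invFun := g
    left_inv := LieHom.congr_fun hgf
    right_inv := LieHom.congr_fun hfg }

end PartCommMetabelianLieAlgebra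

/-! ### The affine Lie algebra -/

/-- The semidirect product of `A`, acting by multiplication, with the abelian Lie algebra `A`. -/
@[ext]
structure AffineLie (A : Type*) where
  lin : A
  vec : A

namespace AffineLie

variable {A : Type*} [CommRing A]

/-- The underlying pair. -/
def equivProd (A : Type*) : AffineLie A ≃ A × A where
  toFun a := (a.lin, a.vec)
  invFun a := ⟨a.1, a.2⟩

instance : AddCommGroup (AffineLie A) := (equivProd A).addCommGroup

@[simp] theorem zero_lin : (0 : AffineLie A).lin = 0 := rfl
@[simp] theorem zero_vec : (0 : AffineLie A).vec = 0 := rfl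
@[simp] theorem add_lin (a b : AffineLie A) : (a + b).lin = a.lin + b.lin := rfl
@[simp] theorem add_vec (a b : AffineLie A) : (a + b).vec = a.vec + b.vec := rfl

instance : Bracket (AffineLie A) (AffineLie A) where
  bracket a b := ⟨0, a.lin * b.vec - b.lin * a.vec⟩

@[simp] theorem lie_lin (a b : AffineLie A) : ⁅a, b⁆.lin = 0 := rfl
@[simp] theorem lie_vec (a b : AffineLie A) : ⁅a, b⁆.vec = a.lin * b.vec - b.lin * a.vec := rfl

instance : LieRing (AffineLie A) where
  add_lie a b c := by ext <;> simp; ring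
  lie_add a b c := by ext <;> simp; ring
  lie_self a := by ext <;> simp
  leibniz_lie a b c := by ext <;> simp; ring

variable {R : Type*} [CommRing R] [Algebra R A]

instance : Module R (AffineLie A) := (equivProd A).module R

@[simp] theorem smul_lin (r : R) (a : AffineLie A) : (r • a).lin = r • a.lin := rfl
@[simp] theorem smul_vec (r : R) (a : AffineLie A) : (r • a).vec = r • a.vec := rfl

instance : LieAlgebra R (AffineLie A) where
  lie_smul r a b := by ext <;> simp [smul_sub]

theorem isMetabelian : LieRing.IsMetabelian (AffineLie A) := fun a b c d => by
  ext <;> simp only [lie_lin, lie_vec, zero_lin, zero_vec, zero_mul, sub_zero]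

variable (A R) in
/-- The second component as a linear map. -/
def vecₗ : AffineLie A →ₗ[R] A where
  toFun := vec
  map_add' _ _ := rfl
  map_smul' _ _ := rfl

@[simp] theorem vecₗ_apply (a : AffineLie A) : vecₗ A R a = a.vec := rfl

end AffineLie

/-! ### Left-normed monomials in metabelian Lie algebras -/

namespace MetabelianMonomial

variable {R : Type u} [CommRing R] {L : Type v} [LieRing L] [LieAlgebra R L] {ι : Type w}

/-- By Leibniz the two sides differ by `⁅⁅a, b⁆, z⁆`, a bracket of two elements of the derived
ideal. Hence the derived ideal is a module over commuting variables, and the letters acting on it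
form a multiset. -/
theorem lie_lie_comm_of_mem (hL : LieRing.IsMetabelian L) (a b : L) {z : L}
    (hz : z ∈ LieAlgebra.derivedSeries R L 1) : ⁅a, ⁅b, z⁆⁆ = ⁅b, ⁅a, z⁆⁆ := by
  rw [leibniz_lie, add_eq_right]
  replace hz := (LieAlgebra.coe_derivedSeries_one_eq R L).le hz
  induction hz using Submodule.span_induction with
  | zero => simp
  | add _ _ _ _ h₁ h₂ => rw [lie_add, h₁, h₂, add_zero]
  | smul r _ _ h₁ => rw [lie_smul, h₁, smul_zero]
  | mem z hz =>
    obtain ⟨p, q, rfl⟩ := hz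
    exact hL _ _ _ _

theorem lie_mem_derivedSeries_one (a b : L) : ⁅a, b⁆ ∈ LieAlgebra.derivedSeries R L 1 :=
  LieSubmodule.lie_mem_lie (LieSubmodule.mem_top _) (LieSubmodule.mem_top _)

variable (R) in
/-- The action of a monomial in the variables `x k` on the derived ideal. -/
def act (hL : LieRing.IsMetabelian L) (x : ι → L) (s : Multiset ι)
    (z : LieAlgebra.derivedSeries R L 1) : LieAlgebra.derivedSeries R L 1 :=
  haveI : LeftCommutative fun k (z : LieAlgebra.derivedSeries R L 1) => ⁅x k, z⁆ :=
    ⟨fun _ _ z => Subtype.ext (lie_lie_comm_of_mem hL _ _ z.2)⟩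
  s.foldr (fun k z => ⁅x k, z⁆) z

variable (hL : LieRing.IsMetabelian L) (x : ι → L)

theorem act_cons (k : ι) (s : Multiset ι) (z : LieAlgebra.derivedSeries R L 1) :
    act R hL x (k ::ₘ s) z = ⁅x k, act R hL x s z⁆ :=
  haveI : LeftCommutative fun k (z : LieAlgebra.derivedSeries R L 1) => ⁅x k, z⁆ :=
    ⟨fun _ _ z => Subtype.ext (lie_lie_comm_of_mem hL _ _ z.2)⟩
  Multiset.foldr_cons _ _ _ _

theorem act_cons' (k : ι) (s : Multiset ι) (z : LieAlgebra.derivedSeries R L 1) :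
    act R hL x (k ::ₘ s) z = act R hL x s ⁅x k, z⁆ := by
  induction s using Multiset.induction_on with
  | empty => rfl
  | cons l s ih => rw [Multiset.cons_swap, act_cons, ih, act_cons]

theorem act_sub (s : Multiset ι) (z w : LieAlgebra.derivedSeries R L 1) :
    act R hL x s (z - w) = act R hL x s z - act R hL x s w := by
  induction s using Multiset.induction_on with
  | empty => rfl
  | cons l s ih => rw [act_cons, ih, lie_sub, act_cons, act_cons]

theorem act_zero (s : Multiset ι) : act R hL x s 0 = 0 := by
  simpa only [sub_self] using act_sub hL x s 0 0

theorem act_neg (s : Multiset ι) (z : LieAlgebra.derivedSeries R L 1) :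
    act R hL x s (-z) = -act R hL x s z := by
  rw [← zero_sub z, act_sub, act_zero, zero_sub]

variable (R) in
/-- The monomial `⁅x k₁, ⁅x k₂, … ⁅x a, x b⁆⁆⁆`, where `s` is the multiset of the `kᵢ`. -/
def mon (a b : ι) (s : Multiset ι) : LieAlgebra.derivedSeries R L 1 :=
  act R hL x s ⟨⁅x a, x b⁆, lie_mem_derivedSeries_one _ _⟩

theorem mon_cons (a b k : ι) (s : Multiset ι) :
    mon R hL x a b (k ::ₘ s) = ⁅x k, mon R hL x a b s⁆ := act_cons hL x k s _

theorem mon_self (a : ι) (s : Multiset ι) : mon R hL x a a s = 0 := by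
  have : (⟨⁅x a, x a⁆, lie_mem_derivedSeries_one _ _⟩ : LieAlgebra.derivedSeries R L 1) = 0 :=
    Subtype.ext (lie_self _)
  rw [mon, this, act_zero]

theorem mon_swap (a b : ι) (s : Multiset ι) : mon R hL x b a s = -mon R hL x a b s := by
  rw [mon, mon, ← act_neg]
  congr 1
  exact Subtype.ext (lie_skew _ _).symm

theorem mon_eq_zero {a b : ι} (h : ⁅x a, x b⁆ = 0) (s : Multiset ι) : mon R hL x a b s = 0 := by
  have : (⟨⁅x a, x b⁆, lie_mem_derivedSeries_one _ _⟩ : LieAlgebra.derivedSeries R L 1) = 0 :=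
    Subtype.ext h
  rw [mon, this, act_zero]

/-- The Jacobi identity for `x a`, `x b`, `x c`, acted upon by `s`. It brings a chosen letter `c`
into the innermost bracket. -/
theorem mon_jacobi (a b c : ι) (s : Multiset ι) :
    mon R hL x a b (c ::ₘ s) = mon R hL x c b (a ::ₘ s) - mon R hL x c a (b ::ₘ s) := by
  simp only [mon, act_cons', ← act_sub]
  congr 1
  refine Subtype.ext ?_
  change ⁅x c, ⁅x a, x b⁆⁆ = ⁅x a, ⁅x c, x b⁆⁆ - ⁅x b, ⁅x c, x a⁆⁆
  rw [leibniz_lie, ← lie_skew (x b) ⁅x c, x a⁆]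
  abel

/-- Within a fixed multidegree the monomials are differences of a potential. -/
theorem exists_potential [DecidableEq ι] (β : Multiset ι) :
    ∃ φ : ι → LieAlgebra.derivedSeries R L 1, ∀ a b s, a ::ₘ b ::ₘ s = β →
      mon R hL x a b s = φ b - φ a := by
  rcases Multiset.empty_or_exists_mem β with rfl | ⟨c, hc⟩
  · exact ⟨0, fun a b s h => (Multiset.cons_ne_zero h).elim⟩
  -- A base letter `c` of `β` is fixed. If `b = c` occurs only once, the second `erase` does
  -- nothing, which is harmless because the monomial is then zero by `mon_self`.
  refine ⟨fun b => mon R hL x c b ((β.erase c).erase b), ?_⟩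
  rintro a b s rfl
  beta_reduce
  simp only [Multiset.mem_cons] at hc
  by_cases hca : c = a
  · subst hca
    simp [mon_self]
  by_cases hcb : c = b
  · subst hcb
    rw [mon_self, Multiset.cons_swap, Multiset.erase_cons_head, Multiset.erase_cons_head,
      zero_sub, mon_swap]
  · obtain ⟨s, rfl⟩ := Multiset.exists_cons_of_mem (hc.resolve_left hca |>.resolve_left hcb)
    have h : (a ::ₘ b ::ₘ c ::ₘ s).erase c = a ::ₘ b ::ₘ s := by
      rw [Multiset.cons_swap b c, Multiset.cons_swap a c, Multiset.erase_cons_head]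
    rw [h, Multiset.erase_cons_head, Multiset.cons_swap, Multiset.erase_cons_head, mon_jacobi]

/-- The monomials span the derived ideal. -/
theorem lie_mem_span_mon
    (hx : ∀ S : LieSubalgebra R L, (∀ k, x k ∈ S) → S = ⊤) (a b : L) :
    ⁅a, b⁆ ∈ Submodule.span R
      (Set.range fun t : ι × ι × Multiset ι => (mon R hL x t.1 t.2.1 t.2.2 : L)) := by
  set W := Submodule.span R
    (Set.range fun t : ι × ι × Multiset ι => (mon R hL x t.1 t.2.1 t.2.2 : L)) with hW
  have hW₁ (k : ι) {z : L} (hz : z ∈ W) : ⁅x k, z⁆ ∈ W := by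
    induction hz using Submodule.span_induction with
    | zero => simp
    | add _ _ _ _ h₁ h₂ => rw [lie_add]; exact W.add_mem h₁ h₂
    | smul r _ _ h₁ => rw [lie_smul]; exact W.smul_mem _ h₁
    | mem z hz =>
      obtain ⟨t, rfl⟩ := hz
      refine Submodule.subset_span ⟨(t.1, t.2.1, k ::ₘ t.2.2), ?_⟩
      simp only [mon_cons]
      rfl
  -- The three subalgebras extend closure properties from generators to all elements: `S₁` shows
  -- that `W` is stable under the whole algebra, then `S₂` and `S₃` free the left and the right
  -- entry of the bracket.
  let S₁ : LieSubalgebra R L :=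
    { carrier := {u | ∀ z ∈ W, ⁅u, z⁆ ∈ W}
      add_mem' := fun h₁ h₂ z hz => by rw [add_lie]; exact W.add_mem (h₁ z hz) (h₂ z hz)
      zero_mem' := fun z _ => by rw [zero_lie]; exact W.zero_mem
      smul_mem' := fun r u h z hz => by rw [smul_lie]; exact W.smul_mem r (h z hz)
      lie_mem' := fun {u v} h₁ h₂ z hz => by
        rw [lie_lie]
        exact W.sub_mem (h₁ _ (h₂ z hz)) (h₂ _ (h₁ z hz)) }
  have hS₁ (u : L) {z : L} (hz : z ∈ W) : ⁅u, z⁆ ∈ W := by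
    have : u ∈ S₁ := by rw [hx S₁ fun k z hz => hW₁ k hz]; trivial
    exact this z hz
  let S₂ : LieSubalgebra R L :=
    { carrier := {u | ∀ k, ⁅u, x k⁆ ∈ W}
      add_mem' := fun h₁ h₂ k => by rw [add_lie]; exact W.add_mem (h₁ k) (h₂ k)
      zero_mem' := fun k => by rw [zero_lie]; exact W.zero_mem
      smul_mem' := fun r u h k => by rw [smul_lie]; exact W.smul_mem r (h k)
      lie_mem' := fun {u v} h₁ h₂ k => by
        rw [lie_lie]
        exact W.sub_mem (hS₁ _ (h₂ k)) (hS₁ _ (h₁ k)) }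
  have hS₂ (u : L) (k : ι) : ⁅u, x k⁆ ∈ W := by
    have : u ∈ S₂ := by
      rw [hx S₂ fun l k => Submodule.subset_span ⟨(l, k, 0), rfl⟩]; trivial
    exact this k
  let S₃ : LieSubalgebra R L :=
    { carrier := {v | ∀ u, ⁅u, v⁆ ∈ W}
      add_mem' := fun h₁ h₂ u => by rw [lie_add]; exact W.add_mem (h₁ u) (h₂ u)
      zero_mem' := fun u => by rw [lie_zero]; exact W.zero_mem
      smul_mem' := fun r v h u => by rw [lie_smul]; exact W.smul_mem r (h u)
      lie_mem' := fun {v w} h₁ h₂ u => hS₁ u (h₂ v) }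
  have : b ∈ S₃ := by rw [hx S₃ fun k u => hS₂ u k]; trivial
  exact this a

end MetabelianMonomial

/-! ### Arcs in a cycle -/

/-- The pairs `i < j` of vertices that are not adjacent in the cycle of length `n`. -/
abbrev CycleChord (n : ℕ) : Type :=
  {e : Fin n × Fin n // e.1.val + 1 < e.2.val ∧ e.2.val + 1 < e.1.val + n}

namespace CycleChord

/-- The indicator function of the open arc between `i` and `j`. -/
def ind (R : Type*) [Zero R] [One R] {n : ℕ} (i j k : Fin n) : R := if i < k ∧ k < j then 1 else 0

/-- Chords of the shorter cycle remain chords of the longer one, while the closing edge from `0` to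
`m - 1` becomes a new chord. -/
theorem card_lt_card {m n : ℕ} (hm : 3 ≤ m) (hmn : m < n) :
    Fintype.card (CycleChord m) < Fintype.card (CycleChord n) := by
  refine Fintype.card_lt_of_injective_of_notMem
    (fun e => ⟨(e.1.1.castLE hmn.le, e.1.2.castLE hmn.le), ?_⟩) ?_
    (b := ⟨(⟨0, by omega⟩, ⟨m - 1, by omega⟩), ?_⟩) ?_
  · have := e.2
    simp only [Fin.val_castLE]
    omega
  · rintro ⟨⟨a, b⟩, h⟩ ⟨⟨c, d⟩, h'⟩ he
    simpa [Subtype.ext_iff, Prod.ext_iff, Fin.ext_iff] using he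
  · simp only
    omega
  · rintro ⟨⟨⟨a, b⟩, h⟩, he⟩
    simp only [Subtype.ext_iff, Prod.ext_iff, Fin.ext_iff, Fin.val_castLE] at he
    simp only at h
    omega

/-- A function on a set `S ∌ 0` of naturals that does not jump inside `S` is a sum of jumps located
outside `S`. -/
theorem exists_jumps {W : Type*} [AddCommGroup W] (S : Set ℕ) (h0 : 0 ∉ S) (g : ℕ → W)
    (hg : ∀ p, p ∈ S → p + 1 ∈ S → g p = g (p + 1)) :
    ∃ w : ℕ → W, (∀ j ∈ S, w j = 0) ∧ ∀ p ∈ S, g p = ∑ j ∈ Finset.range p, w j := by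
  classical
  -- `G` agrees with `g` on `S` and keeps its value on leaving a point of `S`, so it can jump only
  -- after points outside `S`. The start value 0 is free since `0 ∉ S`.
  let G : ℕ → W := fun p => Nat.rec 0 (fun q z => if q ∈ S then z else g (q + 1)) p
  have hG (q : ℕ) : G (q + 1) = if q ∈ S then G q else g (q + 1) := rfl
  refine ⟨fun j => G (j + 1) - G j, fun j hj => by simp only [hG, if_pos hj, sub_self],
    fun p hp => ?_⟩
  rw [Finset.sum_range_sub, show G 0 = 0 from rfl, sub_zero]
  induction p with
  | zero => exact (h0 hp).elim
  | succ q ih =>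
    by_cases hq : q ∈ S
    · rw [hG, if_pos hq, ← ih hq, hg q hq hp]
    · rw [hG, if_neg hq]

/-- A combination of differences vanishes on every function that is constant along the edges of the
cycle inside `S` as soon as it vanishes on the arcs cut out by chords with both ends outside `S`. -/
theorem sum_smul_sub_eq_zero {R W τ : Type*} [CommRing R] [AddCommGroup W] [Module R W] {n : ℕ}
    {S : Set (Fin n)} {i₀ : Fin n} (hi₀ : i₀ ∉ S) (T : Finset τ) (c : τ → R) (a b : τ → Fin n)
    (ha : ∀ t ∈ T, a t ∈ S) (hb : ∀ t ∈ T, b t ∈ S) (φ : Fin n → W)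
    (hφ : ∀ k ∈ S, ∀ l ∈ S, (k.val + 1 = l.val ∨ k.val + 1 = n ∧ l.val = 0) → φ k = φ l)
    (hc : ∀ e : CycleChord n, e.1.1 ∉ S → e.1.2 ∉ S →
      ∑ t ∈ T, c t * (ind R e.1.1 e.1.2 (b t) - ind R e.1.1 e.1.2 (a t)) = 0) :
    ∑ t ∈ T, c t • (φ (b t) - φ (a t)) = 0 := by
  have hn : 0 < n := i₀.pos
  -- Adjacent pairs come for free: off its ends, the arc they cut out is empty or everything, so the
  -- indicator is constant on `S`.
  have hc' : ∀ i j : Fin n, i < j → i ∉ S → j ∉ S →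
      ∑ t ∈ T, c t * (ind R i j (b t) - ind R i j (a t)) = 0 := by
    intro i j hij hi hj
    by_cases h : i.val + 1 < j.val ∧ j.val + 1 < i.val + n
    · exact hc ⟨(i, j), h⟩ hi hj
    refine Finset.sum_eq_zero fun t ht => ?_
    suffices ∀ k ∈ S, ind R i j k = if i.val + 1 = j.val then 0 else 1 by
      rw [this _ (ha t ht), this _ (hb t ht), sub_self, mul_zero]
    intro k hk
    have hki : k ≠ i := fun h => hi (h ▸ hk)
    have hkj : k ≠ j := fun h => hj (h ▸ hk)
    have := k.2
    simp only [ind, Fin.lt_def, ne_eq, Fin.ext_iff] at *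
    split_ifs <;> first | rfl | omega
  -- The cycle is cut open at `i₀`: `pos` counts the steps forward from `i₀`, and `pt` is its
  -- inverse on `p < n`.
  let pos : Fin n → ℕ := fun k => if i₀ ≤ k then k.val - i₀.val else n + k.val - i₀.val
  let pt : ℕ → Fin n := fun p => ⟨(i₀.val + p) % n, Nat.mod_lt _ hn⟩
  have hpt (p : ℕ) (hp : p < n) :
      (pt p).val = if i₀.val + p < n then i₀.val + p else i₀.val + p - n := by
    simp only [pt]
    split_ifs with h
    · exact Nat.mod_eq_of_lt h
    · rw [Nat.mod_eq_sub_mod (not_lt.1 h), Nat.mod_eq_of_lt (by omega)]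
  have hpos_lt (k : Fin n) : pos k < n := by
    have := i₀.2
    have := k.2
    simp only [pos, Fin.le_def]
    split_ifs <;> omega
  have hpt_pos (k : Fin n) : pt (pos k) = k := by
    have := i₀.2
    have := k.2
    rw [Fin.ext_iff, hpt _ (hpos_lt k)]
    simp only [pos, Fin.le_def]
    split_ifs <;> omega
  obtain ⟨w, hw₁, hw₂⟩ := exists_jumps {p | p < n ∧ pt p ∈ S}
    (fun h => hi₀ (by
      have := h.2
      rwa [show pt 0 = i₀ from Fin.ext (by rw [hpt 0 hn]; simp)] at this))
    (φ ∘ pt) (by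
      rintro p ⟨hp, hpS⟩ ⟨hp', hpS'⟩
      refine hφ _ hpS _ hpS' ?_
      rw [hpt _ hp, hpt _ hp']
      have := i₀.2
      split_ifs <;> omega)
  have hφw (k : Fin n) (hk : k ∈ S) :
      φ k = ∑ j ∈ Finset.range n, (if j < pos k then (1 : R) else 0) • w j := by
    have := hw₂ (pos k) ⟨hpos_lt k, by rwa [hpt_pos]⟩
    rw [Function.comp_apply, hpt_pos] at this
    rw [this]
    simp only [ite_smul, one_smul, zero_smul]
    rw [← Finset.sum_filter]
    refine Finset.sum_congr ?_ fun _ _ => rfl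
    have := hpos_lt k
    ext j
    simp only [Finset.mem_range, Finset.mem_filter]
    omega
  calc ∑ t ∈ T, c t • (φ (b t) - φ (a t))
      = ∑ t ∈ T, ∑ j ∈ Finset.range n, (c t * ((if j < pos (b t) then (1 : R) else 0) -
          (if j < pos (a t) then (1 : R) else 0))) • w j := by
        refine Finset.sum_congr rfl fun t ht => ?_
        rw [hφw _ (ha t ht), hφw _ (hb t ht), ← Finset.sum_sub_distrib, Finset.smul_sum]
        refine Finset.sum_congr rfl fun j _ => ?_
        rw [← sub_smul, smul_smul]
    _ = ∑ j ∈ Finset.range n, (∑ t ∈ T, c t * ((if j < pos (b t) then (1 : R) else 0) -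
          (if j < pos (a t) then (1 : R) else 0))) • w j := by
        rw [Finset.sum_comm]
        simp only [Finset.sum_smul]
    _ = 0 := by
        refine Finset.sum_eq_zero fun j hj => ?_
        have hj := Finset.mem_range.1 hj
        by_cases hjS : pt j ∈ S
        · rw [hw₁ j ⟨hj, hjS⟩, smul_zero]
        suffices h : ∑ t ∈ T, c t * ((if j < pos (b t) then (1 : R) else 0) -
            (if j < pos (a t) then (1 : R) else 0)) = 0 by rw [h, zero_smul]
        have hi := i₀.2
        have hptj := hpt j hj
        -- The condition `j < pos k` puts `k` on the arc running forward from `pt j` to `i₀`. On `S`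
        -- this is the complement of an index interval, everything, or an index interval, according
        -- to the order of `i₀` and `pt j`.
        rcases lt_trichotomy i₀ (pt j) with h | h | h
        · have key (k : Fin n) (hk : k ∈ S) :
              (if j < pos k then (1 : R) else 0) = 1 - ind R i₀ (pt j) k := by
            have hki : k ≠ i₀ := fun h => hi₀ (h ▸ hk)
            have hkj : k ≠ pt j := fun h => hjS (h ▸ hk)
            have := k.2
            simp only [ind, pos, Fin.lt_def, Fin.le_def, ne_eq, Fin.ext_iff] at *
            split_ifs at * <;> first | simp; done | omega
          rw [← neg_eq_zero, ← Finset.sum_neg_distrib]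
          refine (Finset.sum_congr rfl fun t ht => ?_).trans (hc' _ _ h hi₀ hjS)
          rw [key _ (ha t ht), key _ (hb t ht)]
          ring
        · refine Finset.sum_eq_zero fun t ht => ?_
          suffices ∀ k ∈ S, j < pos k by
            rw [if_pos (this _ (ha t ht)), if_pos (this _ (hb t ht)), sub_self, mul_zero]
          intro k hk
          have hki : k ≠ i₀ := fun h => hi₀ (h ▸ hk)
          have := k.2
          simp only [pos, Fin.le_def, ne_eq, Fin.ext_iff] at *
          split_ifs at * <;> omega
        · have key (k : Fin n) (hk : k ∈ S) :
              (if j < pos k then (1 : R) else 0) = ind R (pt j) i₀ k := by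
            have hki : k ≠ i₀ := fun h => hi₀ (h ▸ hk)
            have hkj : k ≠ pt j := fun h => hjS (h ▸ hk)
            have := k.2
            simp only [ind, pos, Fin.lt_def, Fin.le_def, ne_eq, Fin.ext_iff] at *
            split_ifs at * <;> first | rfl | omega
          refine (Finset.sum_congr rfl fun t ht => ?_).trans (hc' _ _ h hjS hi₀)
          rw [key _ (ha t ht), key _ (hb t ht)]

end CycleChord

/-! ### Nested brackets -/

/-- The nested bracket `⁅x k₁, ⁅x k₂, … z⁆⁆` for a list `k₁, k₂, …`. -/
def nestedLie {ι L : Type*} [LieRing L] (x : ι → L) (l : List ι) (z : L) : L :=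
  l.foldr (fun k z => ⁅x k, z⁆) z

section NestedLie

variable {ι R L L' : Type*} [CommRing R] [LieRing L] [LieAlgebra R L] [LieRing L'] [LieAlgebra R L']

theorem LieHom.map_nestedLie (f : L →ₗ⁅R⁆ L') (x : ι → L) (l : List ι) (z : L) :
    f (nestedLie x l z) = nestedLie (fun k => f (x k)) l (f z) := by
  induction l with
  | nil => rfl
  | cons k l ih => exact (f.map_lie _ _).trans (congrArg (fun w => ⁅f (x k), w⁆) ih)

variable (R) in
theorem nestedLie_mem_derivedSeries_one (x : ι → L) (l : List ι) (a b : L) :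
    nestedLie x l ⁅a, b⁆ ∈ LieAlgebra.derivedSeries R L 1 := by
  cases l <;> exact MetabelianMonomial.lie_mem_derivedSeries_one _ _

/-- Brackets have zero linear part, so each further letter just multiplies the second component by
its own linear part. -/
theorem AffineLie.nestedLie_lie_vec {A : Type*} [CommRing A] (x : ι → AffineLie A) (l : List ι)
    (a b : AffineLie A) :
    (nestedLie x l ⁅a, b⁆).vec = (l.map fun k => (x k).lin).prod * ⁅a, b⁆.vec := by
  have h (l : List ι) : (nestedLie x l ⁅a, b⁆).lin = 0 := by cases l <;> rfl
  induction l with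
  | nil => simp [nestedLie]
  | cons k l ih =>
    change ⁅x k, nestedLie x l ⁅a, b⁆⁆.vec = _
    rw [AffineLie.lie_vec, ih, h, zero_mul, sub_zero, List.map_cons, List.prod_cons, mul_assoc]

end NestedLie

/-! ### Chord homomorphisms -/

theorem cycleGraph_adj_iff_val {n : ℕ} (hn : 3 ≤ n) {u v : Fin n} :
    (SimpleGraph.cycleGraph n).Adj u v ↔
      (u.val + 1 = v.val ∨ u.val + 1 = n ∧ v.val = 0) ∨
      (v.val + 1 = u.val ∨ v.val + 1 = n ∧ u.val = 0) := by
  have hu := u.2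
  have hv := v.2
  rw [SimpleGraph.cycleGraph_adj']
  rcases lt_trichotomy u v with h | rfl | h
  · rw [Fin.coe_sub_iff_lt.2 h, Fin.sub_val_of_le h.le]
    rw [Fin.lt_def] at h
    omega
  · rw [Fin.sub_val_of_le le_rfl]
    omega
  · rw [Fin.coe_sub_iff_lt.2 h, Fin.sub_val_of_le h.le]
    rw [Fin.lt_def] at h
    omega

namespace CycleChord

open MvPolynomial

variable (R : Type u) [CommRing R] {n : ℕ}

/-- The variable `X k`, or `0` at the two ends of the chord. -/
noncomputable def coord (e : CycleChord n) (k : Fin n) : MvPolynomial (Fin n) R :=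
  if k = e.1.1 ∨ k = e.1.2 then 0 else X k

/-- The homomorphism that kills the ends of the chord `e` and separates the arcs cut out by it. -/
noncomputable def hom (hn : 3 ≤ n) (e : CycleChord n) :
    PartCommMetabelianLieAlgebra R (SimpleGraph.cycleGraph n) →ₗ⁅R⁆
      AffineLie (MvPolynomial (Fin n) R) :=
  PartCommMetabelianLieAlgebra.lift AffineLie.isMetabelian
    (fun k => ⟨coord R e k, coord R e k * C (ind R e.1.1 e.1.2 k)⟩) (by
      intro k l h
      -- The second component of the bracket is `coord k * coord l` times the difference of the
      -- indicators.
      suffices coord R e k = 0 ∨ coord R e l = 0 ∨ ind R e.1.1 e.1.2 k = ind R e.1.1 e.1.2 l by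
        ext1
        · rfl
        · rcases this with h | h | h <;>
            simp only [AffineLie.lie_vec, AffineLie.zero_vec, h] <;> ring
      rw [cycleGraph_adj_iff_val hn] at h
      obtain ⟨⟨i, j⟩, he⟩ := e
      have hi := i.2
      have hj := j.2
      have hk := k.2
      have hl := l.2
      by_cases h₁ : k = i ∨ k = j
      · exact Or.inl (if_pos h₁)
      by_cases h₂ : l = i ∨ l = j
      · exact Or.inr (Or.inl (if_pos h₂))
      refine Or.inr (Or.inr ?_)
      simp only [ind, Fin.lt_def, Fin.ext_iff] at *
      split_ifs <;> first | rfl | omega)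

@[simp]
theorem hom_of (hn : 3 ≤ n) (e : CycleChord n) (k : Fin n) :
    hom R hn e (PartCommMetabelianLieAlgebra.of R _ k) =
      ⟨coord R e k, coord R e k * C (ind R e.1.1 e.1.2 k)⟩ :=
  PartCommMetabelianLieAlgebra.lift_of _ _ _ _

theorem prod_coord (e : CycleChord n) (γ : Multiset (Fin n)) :
    (γ.map (coord R e)).prod =
      if e.1.1 ∈ γ ∨ e.1.2 ∈ γ then 0 else monomial (Multiset.toFinsupp γ) 1 := by
  induction γ using Multiset.induction_on with
  | empty => simp
  | cons k γ ih =>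
    rw [Multiset.map_cons, Multiset.prod_cons, ih, coord]
    by_cases h₁ : k = e.1.1 ∨ k = e.1.2
    · rw [if_pos h₁, zero_mul, if_pos]
      simp only [Multiset.mem_cons]
      tauto
    · by_cases h₂ : e.1.1 ∈ γ ∨ e.1.2 ∈ γ
      · rw [if_pos h₂, mul_zero, if_pos]
        simp only [Multiset.mem_cons]
        tauto
      · rw [if_neg h₁, if_neg h₂, if_neg, X, monomial_mul, mul_one, ← Multiset.singleton_add,
          map_add, Multiset.toFinsupp_singleton]
        simp only [Multiset.mem_cons]
        tauto

/-- The product is zero or the monomial with exponent `γ`. Reading off one coefficient thus isolates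
one multidegree, provided the chord has its ends outside it. -/
theorem coeff_prod_coord_mul (e : CycleChord n) {β : Multiset (Fin n)} (h₁ : e.1.1 ∉ β)
    (h₂ : e.1.2 ∉ β) (γ : Multiset (Fin n)) (r : R) :
    coeff (Multiset.toFinsupp β) ((γ.map (coord R e)).prod * C r) = if γ = β then r else 0 := by
  rw [mul_comm, coeff_C_mul, prod_coord]
  by_cases h : γ = β
  · subst h
    rw [if_neg (not_or.2 ⟨h₁, h₂⟩), coeff_monomial, if_pos rfl, if_pos rfl, mul_one]
  · rw [if_neg h]
    split_ifs
    · rw [coeff_zero, mul_zero]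
    · rw [coeff_monomial, if_neg (fun h' => h (Multiset.toFinsupp.injective h')), mul_zero]

open MetabelianMonomial in
theorem hom_mon (hn : 3 ≤ n) (e : CycleChord n) (a b : Fin n) (s : Multiset (Fin n)) :
    hom R hn e (mon R (PartCommMetabelianLieAlgebra.isMetabelian R _)
        (PartCommMetabelianLieAlgebra.of R (SimpleGraph.cycleGraph n)) a b s) =
      ⟨0, ((a ::ₘ b ::ₘ s).map (coord R e)).prod *
        C (ind R e.1.1 e.1.2 b - ind R e.1.1 e.1.2 a)⟩ := by
  induction s using Multiset.induction_on with
  | empty =>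
    change hom R hn e ⁅_, _⁆ = _
    rw [LieHom.map_lie, hom_of, hom_of]
    ext1
    · rfl
    · simp only [AffineLie.lie_vec, Multiset.map_cons, Multiset.prod_cons, Multiset.map_zero,
        Multiset.prod_zero, C_sub]
      ring
  | cons k s ih =>
    rw [mon_cons]
    change hom R hn e ⁅_, _⁆ = _
    rw [LieHom.map_lie, ih, hom_of]
    ext1
    · rfl
    · simp only [AffineLie.lie_vec, Multiset.map_cons, Multiset.prod_cons, zero_mul, sub_zero]
      ring

open MetabelianMonomial in
/-- The chord homomorphisms are jointly injective on the derived ideal of `M(X; Cₙ)`. -/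
theorem eq_zero_of_hom_vec_eq_zero (hn : 3 ≤ n)
    {z : PartCommMetabelianLieAlgebra R (SimpleGraph.cycleGraph n)}
    (hz : z ∈ LieAlgebra.derivedSeries R
      (PartCommMetabelianLieAlgebra R (SimpleGraph.cycleGraph n)) 1)
    (h : ∀ e : CycleChord n, (hom R hn e z).vec = 0) : z = 0 := by
  classical
  let x := PartCommMetabelianLieAlgebra.of R (SimpleGraph.cycleGraph n)
  have hM := PartCommMetabelianLieAlgebra.isMetabelian R (SimpleGraph.cycleGraph n)
  have hspan : z ∈ Submodule.span R (Set.range fun t : Fin n × Fin n × Multiset (Fin n) =>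
      (mon R hM x t.1 t.2.1 t.2.2 :
        PartCommMetabelianLieAlgebra R (SimpleGraph.cycleGraph n))) := by
    refine Submodule.span_le.2 ?_ ((LieAlgebra.coe_derivedSeries_one_eq R _).le hz)
    rintro _ ⟨a, b, rfl⟩
    exact lie_mem_span_mon hM x PartCommMetabelianLieAlgebra.eq_top_of_forall_of_mem a b
  obtain ⟨c, rfl⟩ := Finsupp.mem_span_range_iff_exists_finsupp.1 hspan
  rw [Finsupp.sum] at h ⊢
  let deg : Fin n × Fin n × Multiset (Fin n) → Multiset (Fin n) := fun t => t.1 ::ₘ t.2.1 ::ₘ t.2.2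
  rw [← Finset.sum_fiberwise_of_maps_to (fun t ht => Finset.mem_image_of_mem deg ht)]
  refine Finset.sum_eq_zero fun β _ => ?_
  obtain ⟨φ, hφ⟩ := exists_potential (R := R) hM x β
  -- The difference of `φ` across an edge is a monomial whose innermost bracket is a defining
  -- relation.
  have hφ' : ∀ k ∈ β, ∀ l ∈ β, (k.val + 1 = l.val ∨ k.val + 1 = n ∧ l.val = 0) → φ k = φ l := by
    intro k hk l hl hkl
    have hadj : (SimpleGraph.cycleGraph n).Adj k l := (cycleGraph_adj_iff_val hn).2 (Or.inl hkl)
    obtain ⟨s, rfl⟩ := Multiset.exists_cons_of_mem hk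
    obtain ⟨s, rfl⟩ := Multiset.exists_cons_of_mem
      ((Multiset.mem_cons.1 hl).resolve_left hadj.ne')
    have := hφ k l s rfl
    rw [mon_eq_zero _ _ (PartCommMetabelianLieAlgebra.lie_of_of_adj R hadj)] at this
    exact (sub_eq_zero.1 this.symm).symm
  have hmem (t) (ht : t ∈ c.support.filter fun t => deg t = β) : t.1 ∈ β ∧ t.2.1 ∈ β := by
    rw [← (Finset.mem_filter.1 ht).2]
    simp [deg]
  suffices ∑ t ∈ c.support.filter (fun t => deg t = β), c t • (φ t.2.1 - φ t.1) = 0 by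
    have h' := congrArg (LieAlgebra.derivedSeries R
      (PartCommMetabelianLieAlgebra R (SimpleGraph.cycleGraph n)) 1).toSubmodule.subtype this
    rw [map_sum, map_zero] at h'
    refine (Finset.sum_congr rfl fun t ht => ?_).trans h'
    rw [map_smul, ← hφ _ _ _ (Finset.mem_filter.1 ht).2]
    rfl
  -- If some vertex is missing from `β`, the cycle can be cut open there, and the coefficients at
  -- `β` of the chord images give the required vanishing. Otherwise `φ` is constant around the whole
  -- cycle and no chord is needed.
  by_cases hall : ∃ i₀, i₀ ∉ β
  · obtain ⟨i₀, hi₀⟩ := hall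
    refine sum_smul_sub_eq_zero (S := {k | k ∈ β}) hi₀ _ c _ _ (fun t ht => (hmem t ht).1)
      (fun t ht => (hmem t ht).2) φ hφ' fun e h₁ h₂ => ?_
    have := congrArg (coeff (Multiset.toFinsupp β)) (h e)
    rw [← AffineLie.vecₗ_apply (R := R), map_sum, map_sum, coeff_sum, coeff_zero] at this
    rw [Finset.sum_filter]
    refine (Finset.sum_congr rfl fun t _ => ?_).trans this
    rw [map_smul, map_smul, hom_mon, AffineLie.vecₗ_apply, coeff_smul,
      coeff_prod_coord_mul R e h₁ h₂, smul_eq_mul, mul_ite, mul_zero]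
  · push Not at hall
    have hconst (p : ℕ) (hp : p < n) : φ ⟨p, hp⟩ = φ ⟨0, by omega⟩ := by
      induction p with
      | zero => rfl
      | succ p ih => rw [← ih (by omega)]; exact (hφ' _ (hall _) _ (hall _) (Or.inl rfl)).symm
    refine Finset.sum_eq_zero fun t _ => ?_
    rw [hconst _ t.1.2, hconst _ t.2.1.2, sub_self, smul_zero]

end CycleChord

/-! ### Universal sentences -/

section Logic

open FirstOrder FirstOrder.Language

theorem FirstOrder.Language.BoundedFormula.IsQF.iInf {L : FirstOrder.Language} {α β : Type*}
    [Finite β] {k : ℕ} {f : β → L.BoundedFormula α k} (h : ∀ b, (f b).IsQF) :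
    (BoundedFormula.iInf f).IsQF := by
  have (l : List β) : ((l.map f).foldr (· ⊓ ·) ⊤).IsQF := by
    induction l with
    | nil => exact BoundedFormula.IsQF.top
    | cons b l ih => exact (h b).inf ih
  exact this _

theorem FirstOrder.Language.BoundedFormula.IsUniversal.alls {L : FirstOrder.Language} {α : Type*}
    {k : ℕ} {φ : L.BoundedFormula α k} (h : φ.IsUniversal) : φ.alls.IsUniversal := by
  induction k with
  | zero => exact h
  | succ k ih => exact ih h.all

variable {R : Type u} [CommRing R] {S : Set R}
  {L₁ : Type v} [LieRing L₁] [LieAlgebra R L₁] {L₂ : Type w} [LieRing L₂] [LieAlgebra R L₂]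

/-- The bracket of two terms. -/
def bracketTerm {α : Type*} (s t : (lieLanguage S).Term α) : (lieLanguage S).Term α :=
  Term.func (L := lieLanguage S) (l := 2) LieFunc.bracket ![s, t]

/-- The constant zero. -/
def zeroTerm {α : Type*} : (lieLanguage S).Term α :=
  Term.func (L := lieLanguage S) (l := 0) LieFunc.zero ![]

theorem realize_bracketTerm {α : Type*} (s t : (lieLanguage S).Term α) (v : α → L₁) :
    (bracketTerm s t).realize v = ⁅s.realize v, t.realize v⁆ := rfl

theorem realize_zeroTerm {α : Type*} (v : α → L₁) : (zeroTerm (S := S)).realize v = 0 := rfl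

/-- The nested bracket as a term. -/
def nestedTerm {α : Type*} (l : List α) (t : (lieLanguage S).Term α) : (lieLanguage S).Term α :=
  l.foldr (fun k t => bracketTerm (Term.var k) t) t

theorem realize_nestedTerm {α : Type*} (l : List α) (t : (lieLanguage S).Term α) (v : α → L₁) :
    (nestedTerm l t).realize v = nestedLie v l (t.realize v) := by
  induction l with
  | nil => rfl
  | cons k l ih => exact (realize_bracketTerm _ _ _).trans (congrArg (fun w => ⁅v k, w⁆) ih)

namespace UniversallyEquivalent

/-- Universally equivalent Lie algebras solve the same finite systems of equations and
inequations. -/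
theorem exists_solution (h : UniversallyEquivalent S L₁ L₂) {k : ℕ} {ι κ : Type*} [Finite ι]
    [Finite κ] (p : ι → (lieLanguage S).Term (Empty ⊕ Fin k))
    (q : κ → (lieLanguage S).Term (Empty ⊕ Fin k))
    (hv : ∃ v : Fin k → L₁, (∀ i, (p i).realize (Sum.elim default v) = 0) ∧
      ∀ j, (q j).realize (Sum.elim default v) ≠ 0) :
    ∃ v : Fin k → L₂, (∀ i, (p i).realize (Sum.elim default v) = 0) ∧
      ∀ j, (q j).realize (Sum.elim default v) ≠ 0 := by
  -- The universal closure of `ψ` says that the system has no solution.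
  let ψ : (lieLanguage S).BoundedFormula Empty k :=
    (BoundedFormula.iInf (fun i => (p i).bdEqual zeroTerm) ⊓
      BoundedFormula.iInf (fun j => ((q j).bdEqual zeroTerm).not)).not
  have hψ : ψ.IsQF :=
    ((BoundedFormula.IsQF.iInf fun _ => (BoundedFormula.IsAtomic.equal _ _).isQF).inf
      (BoundedFormula.IsQF.iInf fun _ => (BoundedFormula.IsAtomic.equal _ _).isQF.not)).not
  have := h ψ.alls hψ.isUniversal.alls
  simp only [Sentence.Realize, BoundedFormula.realize_alls, ψ, BoundedFormula.realize_not,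
    BoundedFormula.realize_inf, BoundedFormula.realize_iInf, BoundedFormula.realize_bdEqual,
    realize_zeroTerm] at this
  by_contra hv'
  obtain ⟨v, hv⟩ := hv
  exact this.2 (fun v hv => hv' ⟨v, hv⟩) v hv

theorem symm (h : UniversallyEquivalent S L₁ L₂) : UniversallyEquivalent S L₂ L₁ :=
  fun φ hφ => (h φ hφ).symm

theorem trans {L₃ : Type*} [LieRing L₃] [LieAlgebra R L₃] (h : UniversallyEquivalent S L₁ L₂)
    (h' : UniversallyEquivalent S L₂ L₃) : UniversallyEquivalent S L₁ L₃ :=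
  fun φ hφ => (h φ hφ).trans (h' φ hφ)

theorem of_lieEquiv (e : L₁ ≃ₗ⁅R⁆ L₂) : UniversallyEquivalent S L₁ L₂ := fun φ _ =>
  let g : L₁ ≃[lieLanguage S] L₂ :=
    { toFun := e
      invFun := e.symm
      left_inv := e.symm_apply_apply
      right_inv := e.apply_symm_apply
      map_fun' := fun {_} f a => by
        cases f with
        | zero => exact e.toLieHom.map_zero
        | neg => exact e.toLieHom.map_neg _
        | add => exact e.toLieHom.map_add _ _
        | bracket => exact e.map_lie _ _
        | smul r => exact e.toLieHom.map_smul _ _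
      map_rel' := fun {_} r _ => r.elim }
  StrongHomClass.realize_sentence g φ

end UniversallyEquivalent

end Logic

/-! ### The system of equations of a cycle -/

namespace CycleChord

variable {n : ℕ}

/-- A vertex between the ends of a chord. -/
def inner (e : CycleChord n) : Fin n := ⟨e.1.1 + 1, by have := e.2; have := e.1.2.2; omega⟩

/-- A vertex beyond the ends of a chord. -/
def outer (e : CycleChord n) : Fin n :=
  -- When the chord starts at `0`, its other end is at most `n - 2`, so `n - 1` lies beyond it.
  if 0 < e.1.1.val then ⟨0, e.1.1.pos⟩ else ⟨n - 1, by have := e.1.1.pos; omega⟩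

/-- All vertices except for the ends of a chord. -/
def rest (e : CycleChord n) : List (Fin n) :=
  (List.finRange n).filter fun k => k ≠ e.1.1 ∧ k ≠ e.1.2

theorem mem_rest {e : CycleChord n} {k : Fin n} : k ∈ e.rest ↔ k ≠ e.1.1 ∧ k ≠ e.1.2 := by
  simp [rest]

/-- The bracket of vertices separated by the chord `e`, acted upon by all vertices that are not
ends of `e` and all vertices that are not ends of `e'`. -/
def element {L : Type*} [LieRing L] (x : Fin n → L) (e e' : CycleChord n) : L :=
  nestedLie x (e'.rest ++ e.rest) ⁅x e.inner, x e.outer⁆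

theorem exists_end_notMem {e e' : CycleChord n} (h : e ≠ e') :
    (e.1.1 ≠ e'.1.1 ∧ e.1.1 ≠ e'.1.2) ∨ (e.1.2 ≠ e'.1.1 ∧ e.1.2 ≠ e'.1.2) := by
  obtain ⟨⟨a, b⟩, h₁⟩ := e
  obtain ⟨⟨c, d⟩, h₂⟩ := e'
  simp only [ne_eq, Subtype.mk.injEq, Prod.mk.injEq, Fin.ext_iff] at h h₁ h₂ ⊢
  omega

variable (R : Type u) [CommRing R]

theorem coord_left (e : CycleChord n) : coord R e e.1.1 = 0 := if_pos (Or.inl rfl)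

theorem coord_right (e : CycleChord n) : coord R e e.1.2 = 0 := if_pos (Or.inr rfl)

theorem coord_ne_zero [Nontrivial R] {e : CycleChord n} {k : Fin n} (h₁ : k ≠ e.1.1)
    (h₂ : k ≠ e.1.2) : coord R e k ≠ 0 := by
  rw [coord, if_neg (not_or.2 ⟨h₁, h₂⟩)]
  exact MvPolynomial.X_ne_zero k

/-- Some end of `e` is not an end of `e'`; it occurs in `e'.rest`, and its coordinate for `e` is
zero. -/
theorem prod_rest_eq_zero {e e' : CycleChord n} (h : e ≠ e') :
    (e'.rest.map (coord R e)).prod = 0 := by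
  refine List.prod_eq_zero (List.mem_map.2 ?_)
  rcases exists_end_notMem h with h | h
  · exact ⟨_, mem_rest.2 h, coord_left R e⟩
  · exact ⟨_, mem_rest.2 h, coord_right R e⟩

/-- No chord `d` equals both `e` and `e'`, so each chord homomorphism kills one of the two blocks of
letters; joint injectivity concludes. -/
theorem element_of_eq_zero (hn : 3 ≤ n) {e e' : CycleChord n} (h : e ≠ e') :
    element (PartCommMetabelianLieAlgebra.of R (SimpleGraph.cycleGraph n)) e e' = 0 := by
  refine eq_zero_of_hom_vec_eq_zero R hn (nestedLie_mem_derivedSeries_one R _ _ _ _) fun d => ?_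
  rw [element, LieHom.map_nestedLie, LieHom.map_lie, AffineLie.nestedLie_lie_vec]
  simp only [hom_of, List.map_append, List.prod_append]
  by_cases hd : d = e'
  · subst hd
    rw [prod_rest_eq_zero R h.symm, mul_zero, zero_mul]
  · rw [prod_rest_eq_zero R hd, zero_mul, zero_mul]

/-- The homomorphism of `e` itself detects the element: no letter involved is an end of `e`, and the
indicator is 1 at `e.inner` and 0 at `e.outer`. -/
theorem element_of_ne_zero [IsDomain R] (hn : 3 ≤ n) (e : CycleChord n) :
    element (PartCommMetabelianLieAlgebra.of R (SimpleGraph.cycleGraph n)) e e ≠ 0 := by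
  intro h
  replace h := congrArg (fun z => (hom R hn e z).vec) h
  simp only [map_zero, AffineLie.zero_vec] at h
  rw [element, LieHom.map_nestedLie, LieHom.map_lie, AffineLie.nestedLie_lie_vec] at h
  have hrest : (e.rest.map (coord R e)).prod ≠ 0 := by
    refine List.prod_ne_zero fun h => ?_
    obtain ⟨k, hk, hk'⟩ := List.mem_map.1 h
    exact coord_ne_zero R (mem_rest.1 hk).1 (mem_rest.1 hk).2 hk'
  have he := e.2
  have h₁ : ind R e.1.1 e.1.2 e.inner = 1 := if_pos (by
    simp only [Fin.lt_def, inner]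
    omega)
  have h₂ : ind R e.1.1 e.1.2 e.outer = 0 := if_neg (by
    simp only [Fin.lt_def, outer]
    split_ifs <;> simp only <;> omega)
  have h₃ : coord R e e.inner ≠ 0 := by
    refine coord_ne_zero R ?_ ?_ <;> simp only [inner, ne_eq, Fin.ext_iff] <;> omega
  have h₄ : coord R e e.outer ≠ 0 := by
    refine coord_ne_zero R ?_ ?_ <;> simp only [outer, ne_eq, Fin.ext_iff] <;>
      split_ifs <;> simp only <;> omega
  simp only [hom_of, List.map_append, List.prod_append, AffineLie.lie_vec, h₁, h₂, map_zero,
    map_one, mul_zero, mul_one, zero_sub, mul_neg, neg_eq_zero, mul_eq_zero, hrest, h₃, h₄,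
    or_self] at h

/-- A solution of the system of the cycle of length `n` in the algebra of the cycle of length `m`
bounds the number of chords. -/
theorem card_le_card_of_solution [IsDomain R] {m : ℕ} (hm : 3 ≤ m)
    (x : Fin n → PartCommMetabelianLieAlgebra R (SimpleGraph.cycleGraph m))
    (h₀ : ∀ e e' : CycleChord n, e ≠ e' → element x e e' = 0)
    (h₁ : ∀ e : CycleChord n, element x e e ≠ 0) :
    Fintype.card (CycleChord n) ≤ Fintype.card (CycleChord m) := by
  have hvec (d : CycleChord m) (e e' : CycleChord n) :
      (hom R hm d (element x e e')).vec =
        (e'.rest.map fun k => (hom R hm d (x k)).lin).prod *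
        (e.rest.map fun k => (hom R hm d (x k)).lin).prod *
        ⁅hom R hm d (x e.inner), hom R hm d (x e.outer)⁆.vec := by
    rw [element, LieHom.map_nestedLie, LieHom.map_lie, AffineLie.nestedLie_lie_vec,
      List.map_append, List.prod_append]
  have hex (e : CycleChord n) : ∃ d : CycleChord m, (hom R hm d (element x e e)).vec ≠ 0 := by
    by_contra! h
    exact h₁ e (eq_zero_of_hom_vec_eq_zero R hm (nestedLie_mem_derivedSeries_one R _ _ _ _) h)
  choose d hd using hex
  refine Fintype.card_le_of_injective d fun e e' hee' => ?_
  by_contra hne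
  have h₂ := hd e
  have h₃ := hd e'
  rw [hvec] at h₂ h₃
  rw [← hee'] at h₃
  have h₄ := hvec (d e) e e'
  rw [h₀ e e' hne, map_zero, AffineLie.zero_vec] at h₄
  -- The block of `e'` is nonzero by `h₃`, the block of `e` and the bracket by `h₂`. Their product
  -- is the image of the mixed element, which is zero.
  exact mul_ne_zero (mul_ne_zero (left_ne_zero_of_mul (left_ne_zero_of_mul h₃))
    (right_ne_zero_of_mul (left_ne_zero_of_mul h₂))) (right_ne_zero_of_mul h₂) h₄.symm

/-- The term defining `CycleChord.element`. -/
def term (S : Set R) (e e' : CycleChord n) : (lieLanguage S).Term (Empty ⊕ Fin n) :=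
  nestedTerm ((e'.rest ++ e.rest).map Sum.inr)
    (bracketTerm (FirstOrder.Language.Term.var (Sum.inr e.inner))
      (FirstOrder.Language.Term.var (Sum.inr e.outer)))

theorem realize_term {L : Type*} [LieRing L] [LieAlgebra R L] (S : Set R) (e e' : CycleChord n)
    (x : Fin n → L) : (term R S e e').realize (Sum.elim default x) = element x e e' := by
  rw [term, realize_nestedTerm, nestedLie, List.foldr_map]
  rfl

/-- The generators solve the system of the `n`-cycle in their own algebra; a solution transferred to
the `m`-cycle bounds the number of chords. -/
theorem le_of_universallyEquivalent [IsDomain R] {m : ℕ} (hn : 3 ≤ n) (hm : 3 ≤ m) (S : Set R)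
    (h : UniversallyEquivalent S
      (PartCommMetabelianLieAlgebra R (SimpleGraph.cycleGraph n))
      (PartCommMetabelianLieAlgebra R (SimpleGraph.cycleGraph m))) : n ≤ m := by
  obtain ⟨x, hx₀, hx₁⟩ := h.exists_solution
    (fun t : {t : CycleChord n × CycleChord n // t.1 ≠ t.2} => term R S t.1.1 t.1.2)
    (fun e : CycleChord n => term R S e e)
    ⟨PartCommMetabelianLieAlgebra.of R _,
      fun t => (realize_term R S _ _ _).trans (element_of_eq_zero R hn t.2),
      fun e => (realize_term R S _ _ _).trans_ne (element_of_ne_zero R hn e)⟩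
  by_contra! hmn
  refine (card_lt_card hm hmn).not_ge (card_le_card_of_solution R hm x (fun e e' he => ?_)
    fun e => ?_)
  · rw [← realize_term R S]
    exact hx₀ ⟨(e, e'), he⟩
  · rw [← realize_term R S]
    exact hx₁ e

end CycleChord

theorem mainTheorem1 {R : Type u} [CommRing R] [IsDomain R] [CharZero R]
    {n m : ℕ} (hn : 3 ≤ n) (hm : 3 ≤ m)
    {X : Type v} {Y : Type w} (G : SimpleGraph X) (H : SimpleGraph Y)
    (hG : Nonempty (G ≃g SimpleGraph.cycleGraph n))
    (hH : Nonempty (H ≃g SimpleGraph.cycleGraph m))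
    (S : Set R) :
    UniversallyEquivalent S (PartCommMetabelianLieAlgebra R G)
      (PartCommMetabelianLieAlgebra R H) ↔ n = m := by
  obtain ⟨eG⟩ := hG
  obtain ⟨eH⟩ := hH
  have hG := UniversallyEquivalent.of_lieEquiv (S := S) (PartCommMetabelianLieAlgebra.congr R eG)
  have hH := UniversallyEquivalent.of_lieEquiv (S := S) (PartCommMetabelianLieAlgebra.congr R eH)
  constructor
  · intro h
    have h' := (hG.symm.trans h).trans hH
    exact le_antisymm (CycleChord.le_of_universallyEquivalent R hn hm S h')
      (CycleChord.le_of_universallyEquivalent R hm hn S h'.symm)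
  · rintro rfl
    exact hG.trans hH.symm
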